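/- Conventions. For an $n\times n$ complex matrix $A$ write $f_A=\det(\operatorname{diag}(x_1,\dots,x_n)+A)\in\mathbb{C}[x_1,\dots,x_n]$. A polynomial is real stable if its coefficients are real and it has no zero $z\in\mathbb{C}^n$ with $\operatorname{Im} z_i>0$ for all $i$. Matrices $A,B$ are diagonally equivalent if there is an invertible diagonal matrix $D$ with $A=DBD^{-1}$ or $A=DB^TD^{-1}$. A matrix is reducible if, after a permutation of its rows and the same permutation of its columns, it is block upper triangular with two diagonal blocks of positive size; a matrix of positive size that is not reducible is irreducible. Let $A$ be an $n\times n$ complex matrix such that $f=f_A$ is real stable. Let $K\subseteq\mathbb{C}$ be any field containing the coefficients of $f$ (for example $K=\mathbb{R}$ or $K=\mathbb{C}$), and regard $f$ as an element of $K[x_1,\dots,x_n]$. (a) If $f$ is irreducible over $K$, then $A$ is diagonally equivalent to an irreducible Hermitian matrix $H$, and $A$ and $H$ have equal principal minors. (b) If $f=f_1\cdots f_s$ with each $f_k\in K[x_1,\dots,x_n]$ irreducible over $K$, then, after a permutation of its rows and the same permutation of its columns, $A$ is block upper triangular with $s$ irreducible diagonal blocks $A_1,\dots,A_s$. After renumbering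 the factors $f_k$, each $A_k$ is diagonally equivalent to an irreducible Hermitian matrix $H_k$ with the following property: if $T_k$ is the set of row indices of $A$ belonging to the block $A_k$, then $\det(\operatorname{diag}(x_i)_{i\in T_k}+A_k)=\det(\operatorname{diag}(x_i)_{i\in T_k}+H_k)$, and $f_k=c_k\det(\operatorname{diag}(x_i)_{i\in T_k}+H_k)$ for some nonzero constant $c_k\in\mathbb{C}$. (Thus $c_k=1$ if $f_k$ is normalized to have coefficient $1$ at $\prod_{i\in T_k}x_i$.) Conversely, if an $n\times n$ complex matrix $A$ is, after a permutation of its rows and the same permutation of its columns, block upper triangular with each diagonal block diagonally equivalent to a Hermitian matrix, then $f_A$ is real stable. -/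

import Mathlib

open MvPolynomial

namespace StableMatrix

/-- The determinantal polynomial `det (diag (x_i) + A)` of a square matrix `A`, in variables
indexed by the rows of `A`. -/
noncomputable def detPoly {ι R : Type*} [Fintype ι] [DecidableEq ι] [CommRing R]
    (A : Matrix ι ι R) : MvPolynomial ι R :=
  (Matrix.diagonal (fun i => (X i : MvPolynomial ι R)) + A.map C).det

/-- A complex polynomial is real stable if its coefficients are real and it has no zero all of
whose coordinates have strictly positive imaginary part. -/
def IsRealStable {ι : Type*} (f : MvPolynomial ι ℂ) : Prop :=
  (∃ g : MvPolynomial ι ℝ, MvPolynomial.map Complex.ofRealHom g = f) ∧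
    ∀ z : ι → ℂ, (∀ i, 0 < (z i).im) → eval z f ≠ 0

/-- The principal minor of `A` on the rows and columns in `S`. -/
def principalMinor {ι R : Type*} [DecidableEq ι] [CommRing R] (A : Matrix ι ι R)
    (S : Finset ι) : R :=
  (A.submatrix (fun i : S => (i : ι)) (fun i : S => (i : ι))).det

/-- A matrix is reducible if simultaneously permuting its rows and columns makes it block upper
triangular with two diagonal blocks of positive size. -/
def IsReducibleMatrix {ι R : Type*} [Zero R] (A : Matrix ι ι R) : Prop :=
  ∃ (p q : ℕ) (e : Fin p ⊕ Fin q ≃ ι), 0 < p ∧ 0 < q ∧ (A.submatrix e e).toBlocks₂₁ = 0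

/-- A matrix of positive size is irreducible if it is not reducible. The empty matrix does not
count as irreducible. -/
def IsIrreducibleMatrix {ι R : Type*} [Zero R] (A : Matrix ι ι R) : Prop :=
  Nonempty ι ∧ ¬ IsReducibleMatrix A

/-- `A` and `B` are diagonally equivalent if `A = D B D⁻¹` or `A = D Bᵀ D⁻¹` for an invertible
diagonal matrix `D`. -/
def DiagEquivalent {ι F : Type*} [Fintype ι] [DecidableEq ι] [Field F]
    (A B : Matrix ι ι F) : Prop :=
  ∃ d : ι → F, (∀ i, d i ≠ 0) ∧
    (A = Matrix.diagonal d * B * Matrix.diagonal (fun i => (d i)⁻¹) ∨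
      A = Matrix.diagonal d * B.transpose * Matrix.diagonal (fun i => (d i)⁻¹))

end StableMatrix

/-!
The matrices `B(x) = (diag x + A)⁻¹`, for real `x`, carry the whole argument.

Suppose that `det (diag z + A)` is real stable. As a function of two coordinates it is
`det (diag x + A) ((1 + s b_ii) (1 + t b_jj) - s t b_ij b_ji)`, so stability forces `b_ij b_ji ≥ 0`
(`IsRealStable.inv_mul_inv_nonneg`). Moving a third coordinate `x k` is a rank one update of `B`,
which turns this inequality into the nonnegativity of
`(b_ij - τ b_ik b_kj) (b_ji - τ b_jk b_ki)` for all real `τ` but one. Its two roots are therefore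
conjugate, i.e. `b_ij b_jk b_ki` is the conjugate of `b_ik b_kj b_ji`
(`IsRealStable.inv_triple`). When no entry of `B` vanishes, these relations say that the positive
ratios `b_ij / conj b_ji` have the form `ρ i / ρ j`, so that `B diag ρ = diag ρ Bᴴ`; passing to
inverses, `A diag ρ = diag ρ Aᴴ`, and scaling by `√ρ` makes `A` Hermitian
(`IsRealStable.exists_weights`).

If `A` is irreducible, the entries of `B(x)` are nonzero for generic `x`: by the rank one update,
the identically vanishing entries of a row would make `B`, hence `A`, block triangular
(`IsIrreducibleMatrix.exists_inv_ne_zero`). The same fact shows that the polynomial of an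
irreducible matrix is irreducible over `ℂ`, since in a proper factorization some product
`b_ij b_ji` would vanish (`IsIrreducibleMatrix.irreducible_detPoly`).

Hence the irreducible factors of `det (diag x + A)` are the polynomials of the diagonal blocks in
the Frobenius normal form of `A`. They have coefficients in every field `K` containing the
coefficients of the product (`exists_map_eq_detPoly`), so unique factorization over `K` matches
them with any given factorization (`exists_blocks_of_factorization`). Conversely, Hermitian blocks
give real stable factors by the usual argument with `v* (diag z + H) v`.
-/

namespace StableMatrix

/-! ### The determinantal polynomial -/

section DetPoly

variable {ι R S : Type*} [Fintype ι] [DecidableEq ι] [CommRing R] [CommRing S]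

theorem eval_detPoly (A : Matrix ι ι R) (z : ι → R) :
    eval z (detPoly A) = (Matrix.diagonal z + A).det := by
  rw [detPoly, RingHom.map_det]
  congr 1
  ext i j
  by_cases h : i = j
  · subst h; simp
  · simp [h]

theorem map_detPoly (φ : R →+* S) (A : Matrix ι ι R) :
    map φ (detPoly A) = detPoly (A.map φ) := by
  rw [detPoly, detPoly, RingHom.map_det]
  congr 1
  ext1 i j
  by_cases h : i = j
  · subst h; simp
  · simp [h]

theorem rename_detPoly {τ : Type*} (u : ι → τ) (A : Matrix ι ι R) :
    rename u (detPoly A) =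
      (Matrix.diagonal (fun i => (X (u i) : MvPolynomial τ R)) + A.map C).det := by
  rw [detPoly, AlgHom.map_det]
  congr 1
  ext1 i j
  by_cases h : i = j
  · subst h; simp
  · simp [h]

theorem detPoly_transpose (A : Matrix ι ι R) : detPoly A.transpose = detPoly A := by
  rw [detPoly, detPoly, ← Matrix.det_transpose]
  congr 1
  rw [Matrix.transpose_add, Matrix.diagonal_transpose]
  rfl

theorem rename_detPoly_submatrix {κ : Type*} [Fintype κ] [DecidableEq κ] (e : κ ≃ ι)
    (A : Matrix ι ι R) :
    rename e (detPoly (A.submatrix e e)) = detPoly A := by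
  rw [rename_detPoly, detPoly, ← Matrix.det_submatrix_equiv_self e]
  congr 1
  ext1 i j
  by_cases h : i = j
  · subst h; simp
  · simp [h]

theorem detPoly_conj {F : Type*} [Field F] {d : ι → F} (hd : ∀ i, d i ≠ 0) (B : Matrix ι ι F) :
    detPoly (Matrix.diagonal d * B * Matrix.diagonal (fun i => (d i)⁻¹)) = detPoly B := by
  have key : Matrix.diagonal (fun i => (X i : MvPolynomial ι F)) +
      (Matrix.diagonal d * B * Matrix.diagonal (fun i => (d i)⁻¹)).map C =
      Matrix.diagonal (fun i => (C (d i) : MvPolynomial ι F)) *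
        (Matrix.diagonal (fun i => (X i : MvPolynomial ι F)) + B.map C) *
        Matrix.diagonal (fun i => (C (d i)⁻¹ : MvPolynomial ι F)) := by
    ext1 i j
    have h1 : (C (d i) * C (d i)⁻¹ : MvPolynomial ι F) = 1 := by
      rw [← C_mul, mul_inv_cancel₀ (hd i), C_1]
    rw [Matrix.mul_diagonal, Matrix.diagonal_mul, Matrix.add_apply, Matrix.add_apply,
      Matrix.map_apply, Matrix.mul_diagonal, Matrix.diagonal_mul, Matrix.map_apply]
    by_cases h : i = j
    · subst h
      simp only [Matrix.diagonal_apply_eq, C_mul]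
      linear_combination -(X i : MvPolynomial ι F) * h1
    · simp [h]
  rw [detPoly, key, Matrix.det_mul, Matrix.det_mul, mul_right_comm, ← Matrix.det_mul,
    Matrix.diagonal_mul_diagonal]
  have : (fun i => (C (d i) * C (d i)⁻¹ : MvPolynomial ι F)) = 1 := by
    ext1 i; rw [← C_mul, mul_inv_cancel₀ (hd i), C_1]; rfl
  rw [this]
  simp [detPoly]

theorem DiagEquivalent.detPoly_eq {F : Type*} [Field F] {A B : Matrix ι ι F}
    (h : DiagEquivalent A B) : detPoly A = detPoly B := by
  obtain ⟨d, hd, rfl | rfl⟩ := h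
  · exact detPoly_conj hd B
  · rw [detPoly_conj hd, detPoly_transpose]

theorem detPoly_ne_zero {F : Type*} [Field F] [Infinite F] (A : Matrix ι ι F) :
    detPoly A ≠ 0 := by
  intro h
  have : (-A).charpoly = 0 := by
    apply Polynomial.funext
    intro t
    rw [Matrix.eval_charpoly, sub_neg_eq_add, Polynomial.eval_zero]
    have h2 := eval_detPoly A (fun _ => t)
    rw [h, map_zero] at h2
    exact h2.symm
  exact (Matrix.charpoly_monic (-A)).ne_zero this

/-- Simultaneous block triangular form turns `det (diag x + A)` into the product of the polynomials
of the diagonal blocks, each in the variables of its own block. -/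
theorem detPoly_eq_prod_of_blockTriangular {s : ℕ} {m : Fin s → ℕ}
    (e : (Σ k : Fin s, Fin (m k)) ≃ ι) (A : Matrix ι ι R)
    (h : (A.submatrix e e).BlockTriangular Sigma.fst) :
    detPoly A =
      ∏ k, rename (fun i => e ⟨k, i⟩) (detPoly ((A.submatrix e e).blockDiag' k)) := by
  set N : Matrix (Σ k : Fin s, Fin (m k)) (Σ k : Fin s, Fin (m k)) (MvPolynomial ι R) :=
    Matrix.diagonal (fun i => X (e i)) + (A.submatrix e e).map C with hN
  have hdet : detPoly A = N.det := by
    rw [← rename_detPoly_submatrix e A, rename_detPoly]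
  have htri : N.BlockTriangular Sigma.fst :=
    (Matrix.blockTriangular_diagonal _).add (h.map (C : R →+* MvPolynomial ι R))
  rw [hdet, htri.det_fintype]
  refine Finset.prod_congr rfl fun k _ => ?_
  rw [rename_detPoly]
  rw [← Matrix.det_submatrix_equiv_self (Equiv.sigmaSubtype k).symm]
  congr 1
  ext1 i j
  by_cases h : i = j
  · subst h
    simp [hN, Matrix.toSquareBlock_def, Equiv.sigmaSubtype, Matrix.blockDiag'_apply]
  · simp [hN, Matrix.toSquareBlock_def, Equiv.sigmaSubtype, Matrix.blockDiag'_apply, h]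

end DetPoly

/-! ### Reducible matrices and the Frobenius normal form -/

section Reducibility

theorem isReducibleMatrix_iff {ι R : Type*} [Finite ι] [Zero R] (A : Matrix ι ι R) :
    IsReducibleMatrix A ↔
      ∃ T : Set ι, T.Nonempty ∧ Tᶜ.Nonempty ∧ ∀ i ∉ T, ∀ j ∈ T, A i j = 0 := by
  classical
  constructor
  · rintro ⟨p, q, e, hp, hq, h⟩
    refine ⟨Set.range fun i => e (Sum.inl i), ⟨_, ⟨0, hp⟩, rfl⟩, ⟨e (Sum.inr ⟨0, hq⟩), ?_⟩, ?_⟩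
    · rintro ⟨i, hi⟩
      simpa using e.injective hi
    · rintro i hi _ ⟨j, rfl⟩
      obtain ⟨i | i, rfl⟩ := e.surjective i
      · exact absurd ⟨i, rfl⟩ hi
      · exact congrFun (congrFun h i) j
  · rintro ⟨T, ⟨a, ha⟩, ⟨b, hb⟩, h⟩
    let e₁ := (Finite.equivFin T).symm
    let e₂ := (Finite.equivFin {x // x ∉ T}).symm
    let e := (Equiv.sumCongr e₁ e₂).trans (Equiv.sumCompl (· ∈ T))
    have : Nonempty T := ⟨⟨a, ha⟩⟩
    have : Nonempty {x // x ∉ T} := ⟨⟨b, hb⟩⟩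
    refine ⟨_, _, e, Nat.card_pos, Nat.card_pos, ?_⟩
    ext i j
    exact h (e₂ i) (e₂ i).2 (e₁ j) (e₁ j).2

theorem IsIrreducibleMatrix.submatrix {ι κ R : Type*} [Zero R] {A : Matrix ι ι R}
    (h : IsIrreducibleMatrix A) (e : κ ≃ ι) : IsIrreducibleMatrix (A.submatrix e e) := by
  refine ⟨h.1.map e.symm, ?_⟩
  rintro ⟨p, q, u, hp, hq, hu⟩
  exact h.2 ⟨p, q, u.trans e, hp, hq, hu⟩

/-- Irreducibility only depends on the zero pattern of the matrix. -/
theorem IsIrreducibleMatrix.congr {ι R S : Type*} [Zero R] [Zero S] {A : Matrix ι ι R}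
    {B : Matrix ι ι S} (h : IsIrreducibleMatrix A) (hAB : ∀ i j, B i j = 0 → A i j = 0) :
    IsIrreducibleMatrix B := by
  refine ⟨h.1, ?_⟩
  rintro ⟨p, q, u, hp, hq, hu⟩
  refine h.2 ⟨p, q, u, hp, hq, ?_⟩
  ext i j
  exact hAB _ _ (congrFun (congrFun hu i) j)

/-- Every matrix is, up to a simultaneous permutation of rows and columns, block upper triangular
with irreducible diagonal blocks. The permutation is encoded by the map `b` sending an index to the
number of its block. -/
theorem exists_blockTriangular_irreducible {R : Type*} [Zero R] (N : ℕ) :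
    ∀ {ι : Type} [Finite ι] (A : Matrix ι ι R), Nat.card ι ≤ N →
      ∃ (r : ℕ) (b : ι → Fin r), A.BlockTriangular b ∧
        ∀ k, IsIrreducibleMatrix (A.submatrix (fun i : {i // b i = k} => (i : ι)) (fun i => i)) := by
  classical
  induction N with
  | zero =>
    intro ι _ A hN
    have : IsEmpty ι := Finite.card_eq_zero_iff.1 (Nat.le_zero.1 hN)
    exact ⟨0, fun i => isEmptyElim i, fun i => isEmptyElim i, fun k => k.elim0⟩
  | succ N ih =>
    intro ι _ A hN
    rcases isEmpty_or_nonempty ι with hι | hι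
    · exact ⟨0, fun i => isEmptyElim i, fun i => isEmptyElim i, fun k => k.elim0⟩
    by_cases hA : IsReducibleMatrix A
    · obtain ⟨T, ⟨a, ha⟩, ⟨c, hc⟩, h⟩ := (isReducibleMatrix_iff A).1 hA
      have h₁ : Nat.card {x // x ∈ T} ≤ N := by
        have := Finite.card_subtype_lt (p := (· ∈ T)) hc
        omega
      have h₂ : Nat.card {x // x ∉ T} ≤ N := by
        have := Finite.card_subtype_lt (p := (· ∉ T)) (x := a) (not_not.2 ha)
        omega
      obtain ⟨r₁, b₁, ht₁, hi₁⟩ := ih (A.submatrix (fun i : {x // x ∈ T} => (i : ι)) (fun i => i)) h₁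
      obtain ⟨r₂, b₂, ht₂, hi₂⟩ := ih (A.submatrix (fun i : {x // x ∉ T} => (i : ι)) (fun i => i)) h₂
      let b : ι → Fin (r₁ + r₂) := fun i =>
        if hi : i ∈ T then Fin.castAdd r₂ (b₁ ⟨i, hi⟩) else Fin.natAdd r₁ (b₂ ⟨i, hi⟩)
      have hb₁ : ∀ i (hi : i ∈ T), b i = Fin.castAdd r₂ (b₁ ⟨i, hi⟩) := fun i hi => dif_pos hi
      have hb₂ : ∀ i (hi : i ∉ T), b i = Fin.natAdd r₁ (b₂ ⟨i, hi⟩) := fun i hi => dif_neg hi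
      refine ⟨r₁ + r₂, b, ?_, ?_⟩
      · intro i j hij
        by_cases hi : i ∈ T <;> by_cases hj : j ∈ T
        · rw [hb₁ i hi, hb₁ j hj] at hij
          exact ht₁ (i := ⟨i, hi⟩) (j := ⟨j, hj⟩) hij
        · rw [hb₁ i hi, hb₂ j hj, Fin.lt_def, Fin.val_natAdd, Fin.val_castAdd] at hij
          have := (b₁ ⟨i, hi⟩).2
          omega
        · exact h i hi j hj
        · rw [hb₂ i hi, hb₂ j hj] at hij
          exact ht₂ (i := ⟨i, hi⟩) (j := ⟨j, hj⟩) (by simpa using hij)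
      · intro k
        refine Fin.addCases (fun k => ?_) (fun k => ?_) k
        · let e : {i // b i = Fin.castAdd r₂ k} ≃ {i : {x // x ∈ T} // b₁ i = k} :=
            { toFun := fun i =>
                have hi : i.1 ∈ T := by
                  by_contra hi
                  have := i.2
                  rw [hb₂ _ hi, Fin.ext_iff, Fin.val_natAdd, Fin.val_castAdd] at this
                  have := k.2
                  omega
                ⟨⟨i.1, hi⟩, by have := i.2; rw [hb₁ _ hi] at this; simpa using this⟩
              invFun := fun i => ⟨i.1.1, by rw [hb₁ _ i.1.2, i.2]⟩
              left_inv := fun i => rfl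
              right_inv := fun i => rfl }
          exact (hi₁ k).submatrix e
        · let e : {i // b i = Fin.natAdd r₁ k} ≃ {i : {x // x ∉ T} // b₂ i = k} :=
            { toFun := fun i =>
                have hi : i.1 ∉ T := by
                  intro hi
                  have := i.2
                  rw [hb₁ _ hi, Fin.ext_iff, Fin.val_natAdd, Fin.val_castAdd] at this
                  have := (b₁ ⟨_, hi⟩).2
                  omega
                ⟨⟨i.1, hi⟩, by have := i.2; rw [hb₂ _ hi] at this; simpa using this⟩
              invFun := fun i => ⟨i.1.1, by rw [hb₂ _ i.1.2, i.2]⟩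
              left_inv := fun i => rfl
              right_inv := fun i => rfl }
          exact (hi₂ k).submatrix e
    · refine ⟨1, fun _ => 0, fun i j hij => absurd hij (lt_irrefl _), fun k => ?_⟩
      exact IsIrreducibleMatrix.submatrix ⟨hι, hA⟩
        (Equiv.subtypeUnivEquiv fun _ => Subsingleton.elim _ _)

/-- The Frobenius normal form: block upper triangular with irreducible diagonal blocks. -/
theorem exists_equiv_blockTriangular_irreducible {R : Type*} [Zero R] {n : ℕ}
    (A : Matrix (Fin n) (Fin n) R) :
    ∃ (r : ℕ) (m : Fin r → ℕ) (e : (Σ k : Fin r, Fin (m k)) ≃ Fin n),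
      (A.submatrix e e).BlockTriangular Sigma.fst ∧
        ∀ k, IsIrreducibleMatrix ((A.submatrix e e).blockDiag' k) := by
  obtain ⟨r, b, hb, hirr⟩ := exists_blockTriangular_irreducible (Nat.card (Fin n)) A le_rfl
  let u : ∀ k, Fin (Nat.card {i // b i = k}) ≃ {i // b i = k} := fun k => (Finite.equivFin _).symm
  let e := (Equiv.sigmaCongrRight u).trans (Equiv.sigmaFiberEquiv b)
  have he : ∀ a, b (e a) = a.1 := fun a => (u a.1 a.2).2
  refine ⟨r, _, e, ?_, fun k => (hirr k).submatrix (u k)⟩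
  intro i j hij
  exact hb (by rw [he, he]; exact hij)

end Reducibility

/-! ### Inverses of diagonal perturbations and real stability -/

section Inverse

variable {ι F : Type*} [Fintype ι] [DecidableEq ι] [Field F]

theorem det_diagonal_add_two {N : Matrix ι ι F} (hN : N.det ≠ 0) {i j : ι} (hij : i ≠ j) (s t : F) :
    (N + Matrix.diagonal (Pi.single i s + Pi.single j t)).det =
      N.det * ((1 + s * N⁻¹ i i) * (1 + t * N⁻¹ j j) - s * t * (N⁻¹ i j * N⁻¹ j i)) := by
  let U : Matrix ι (Fin 2) F := Matrix.of fun a => ![if a = i then s else 0, if a = j then t else 0]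
  let V : Matrix (Fin 2) ι F :=
    Matrix.of ![fun a => if a = i then 1 else 0, fun a => if a = j then 1 else 0]
  have hUV : Matrix.diagonal (Pi.single i s + Pi.single j t) = U * V := by
    ext a b
    rw [Matrix.mul_apply, Fin.sum_univ_two]
    by_cases hab : a = b
    · subst hab
      by_cases h1 : a = i <;> by_cases h2 : a = j <;> simp [U, V, h1, h2, Pi.single_apply] <;>
        exact fun h h' => absurd h' h
    · rw [Matrix.diagonal_apply_ne _ hab]
      by_cases h1 : a = i <;> by_cases h2 : a = j <;> simp_all [U, V, Ne.symm]
  rw [hUV, Matrix.det_add_mul U V (Ne.isUnit hN), Matrix.det_fin_two]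
  have hV0 : ∀ (M : Matrix ι ι F) b, (V * M) 0 b = M i b := fun M b => by
    simp [V, Matrix.mul_apply]
  have hV1 : ∀ (M : Matrix ι ι F) b, (V * M) 1 b = M j b := fun M b => by
    simp [V, Matrix.mul_apply]
  have hU0 : ∀ (M : Matrix (Fin 2) ι F) b, (M * U) b 0 = M b i * s := fun M b => by
    simp [U, Matrix.mul_apply]
  have hU1 : ∀ (M : Matrix (Fin 2) ι F) b, (M * U) b 1 = M b j * t := fun M b => by
    simp [U, Matrix.mul_apply]
  simp only [Matrix.add_apply, hU0, hU1, hV0, hV1, Matrix.one_apply, Fin.isValue]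
  simp
  left
  ring

theorem det_diagonal_add_single {N : Matrix ι ι F} (hN : N.det ≠ 0) (i : ι) (s : F) :
    (N + Matrix.diagonal (Pi.single i s)).det = N.det * (1 + s * N⁻¹ i i) := by
  have h : Matrix.diagonal (Pi.single i s) =
      Matrix.replicateCol Unit (Pi.single i s) *
        Matrix.replicateRow Unit (Pi.single i 1 : ι → F) := by
    ext a b
    by_cases h1 : a = b <;> by_cases h2 : a = i <;>
      simp_all [Matrix.mul_apply, Pi.single_apply, eq_comm]
  rw [h, Matrix.det_add_replicateCol_mul_replicateRow (Ne.isUnit hN), Matrix.det_unique (n := Unit),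
    Matrix.add_apply]
  simp [Matrix.mul_apply, Pi.single_apply, mul_comm]

/-- Changing one diagonal entry of `N` is a rank one update of its inverse. -/
theorem inv_add_diagonal_single {N : Matrix ι ι F} (hN : N.det ≠ 0) (k : ι) (t : F)
    (ht : 1 + t * N⁻¹ k k ≠ 0) :
    (N + Matrix.diagonal (Pi.single k t)).det ≠ 0 ∧
      ∀ i j, (N + Matrix.diagonal (Pi.single k t))⁻¹ i j =
        N⁻¹ i j - t / (1 + t * N⁻¹ k k) * (N⁻¹ i k * N⁻¹ k j) := by
  set B := N⁻¹ with hB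
  set τ := t / (1 + t * B k k) with hτ
  have hNB : N * B = 1 := Matrix.mul_nonsing_inv _ (Ne.isUnit hN)
  have hmul : (N + Matrix.diagonal (Pi.single k t)) *
      (B - τ • Matrix.of fun i j => B i k * B k j) = 1 := by
    have h1 : N * (Matrix.of fun i j => B i k * B k j) =
        Matrix.of fun i j => (1 : Matrix ι ι F) i k * B k j := by
      ext i j
      rw [← hNB]
      simp only [Matrix.mul_apply, Matrix.of_apply, Finset.sum_mul, mul_assoc]
    rw [Matrix.mul_sub, Matrix.add_mul, Matrix.mul_smul, Matrix.add_mul, hNB, h1]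
    ext i j
    simp only [Matrix.add_apply, Matrix.sub_apply, Matrix.smul_apply, Matrix.of_apply,
      Matrix.diagonal_mul, smul_eq_mul]
    by_cases h : i = k
    · subst h
      simp only [Matrix.one_apply_eq, Pi.single_eq_same]
      have : τ * (1 + t * B i i) = t := div_mul_cancel₀ _ ht
      linear_combination (-B i j) * this
    · simp [h]
  refine ⟨?_, fun i j => ?_⟩
  · intro h0
    have := congrArg Matrix.det hmul
    rw [Matrix.det_mul, h0, zero_mul, Matrix.det_one] at this
    exact zero_ne_one this
  · rw [Matrix.inv_eq_right_inv hmul]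
    rfl

end Inverse

section Stable

variable {ι : Type*} [Fintype ι] [DecidableEq ι]

theorem IsRealStable.det_im_eq_zero {A : Matrix ι ι ℂ} (hA : IsRealStable (detPoly A)) (x : ι → ℝ) :
    ((Matrix.diagonal (fun i => (x i : ℂ)) + A).det).im = 0 := by
  obtain ⟨g, hg⟩ := hA.1
  rw [← eval_detPoly, ← hg, eval_map]
  have : eval₂ Complex.ofRealHom (fun i => (x i : ℂ)) g = ((eval x g : ℝ) : ℂ) := by
    exact (eval₂_comp_left Complex.ofRealHom (RingHom.id ℝ) x g).symm
  rw [this, Complex.ofReal_im]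

theorem IsRealStable.inv_diag_im_eq_zero {A : Matrix ι ι ℂ} (hA : IsRealStable (detPoly A))
    (x : ι → ℝ) (hx : (Matrix.diagonal (fun i => (x i : ℂ)) + A).det ≠ 0) (k : ι) :
    ((Matrix.diagonal (fun i => (x i : ℂ)) + A)⁻¹ k k).im = 0 := by
  set N := Matrix.diagonal (fun i => (x i : ℂ)) + A with hN
  have h1 := hA.det_im_eq_zero x
  have h2 := hA.det_im_eq_zero (x + Pi.single k 1)
  have h3 : Matrix.diagonal (fun i => (((x + Pi.single k 1 : ι → ℝ) i : ℝ) : ℂ)) + A =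
      N + Matrix.diagonal (Pi.single k 1) := by
    rw [hN, add_right_comm, Matrix.diagonal_add]
    congr 2
    ext i
    by_cases h : i = k
    · subst h; simp
    · simp [h]
  rw [h3, det_diagonal_add_single hx] at h2
  have h4 : N⁻¹ k k = N.det * (1 + 1 * N⁻¹ k k) / N.det - 1 := by
    field_simp
    ring
  rw [h4, Complex.sub_im, Complex.div_im, h1, h2]
  simp only [zero_mul, mul_zero, zero_div, sub_zero, Complex.one_im]

/-- The product of two opposite entries of `(diag x + A)⁻¹`, for real `x`, is nonnegative: a
negative value would produce a zero of `det (diag z + A)` whose `i`th and `j`th coordinates are in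
the open upper half-plane, and such a zero survives moving the remaining coordinates off the real
axis. -/
theorem IsRealStable.inv_mul_inv_nonneg {A : Matrix ι ι ℂ} (hA : IsRealStable (detPoly A))
    (x : ι → ℝ) (hx : (Matrix.diagonal (fun i => (x i : ℂ)) + A).det ≠ 0) {i j : ι} (hij : i ≠ j) :
    ∃ w : ℝ, 0 ≤ w ∧ (Matrix.diagonal (fun i => (x i : ℂ)) + A)⁻¹ i j *
      (Matrix.diagonal (fun i => (x i : ℂ)) + A)⁻¹ j i = w := by
  let M : ℝ → Matrix ι ι ℂ := fun ε => Matrix.diagonal (fun i => x i + ε * Complex.I) + A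
  have hM0 : Matrix.diagonal (fun i => (x i : ℂ)) + A = M 0 := by simp [M]
  have h1 := hA.det_im_eq_zero x
  have hbi := hA.inv_diag_im_eq_zero x hx i
  have hbj := hA.inv_diag_im_eq_zero x hx j
  have h2 := hA.det_im_eq_zero (x + (Pi.single i 1 + Pi.single j 1))
  have h3 : Matrix.diagonal
      (fun k => (((x + (Pi.single i 1 + Pi.single j 1) : ι → ℝ) k : ℝ) : ℂ)) + A =
      M 0 + Matrix.diagonal (Pi.single i 1 + Pi.single j 1) := by
    rw [← hM0, add_right_comm, Matrix.diagonal_add]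
    congr 2
    ext k
    by_cases h : k = i <;> by_cases h' : k = j <;> simp [h, h', Pi.single_apply] <;>
      split_ifs <;> simp
  rw [hM0] at h1 hx hbi hbj ⊢
  rw [h3, det_diagonal_add_two hx hij] at h2
  obtain ⟨p, hp⟩ : ∃ p : ℝ, (M 0)⁻¹ i i = p := ⟨_, Complex.ext rfl hbi⟩
  obtain ⟨q, hq⟩ : ∃ q : ℝ, (M 0)⁻¹ j j = q := ⟨_, Complex.ext rfl hbj⟩
  have hw0 : ((M 0)⁻¹ i j * (M 0)⁻¹ j i).im = 0 := by
    have h4 : (M 0)⁻¹ i j * (M 0)⁻¹ j i = (1 + p) * (1 + q) -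
        (M 0).det * ((1 + 1 * (M 0)⁻¹ i i) * (1 + 1 * (M 0)⁻¹ j j) -
          1 * 1 * ((M 0)⁻¹ i j * (M 0)⁻¹ j i)) / (M 0).det := by
      rw [mul_div_cancel_left₀ _ hx, hp, hq]
      ring
    rw [h4, Complex.sub_im, Complex.div_im, h1, h2, ← Complex.ofReal_one, ← Complex.ofReal_add,
      ← Complex.ofReal_add, ← Complex.ofReal_mul, Complex.ofReal_im]
    simp only [zero_mul, mul_zero, zero_div, sub_zero]
  obtain ⟨w, hw⟩ : ∃ w : ℝ, (M 0)⁻¹ i j * (M 0)⁻¹ j i = w := ⟨_, Complex.ext rfl hw0⟩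
  refine ⟨w, ?_, hw⟩
  by_contra! hneg
  -- `s` is chosen so that the equation `det = 0` for the increment `t` of the `j`th coordinate has
  -- its solution in the upper half-plane.
  let s : ℂ := -(p + Complex.I)⁻¹
  let den : ℝ → ℂ := fun ε =>
    (M ε)⁻¹ j j * (1 + s * (M ε)⁻¹ i i) - s * ((M ε)⁻¹ i j * (M ε)⁻¹ j i)
  let t : ℝ → ℂ := fun ε => -(1 + s * (M ε)⁻¹ i i) / den ε
  have hpI : (p + Complex.I : ℂ) ≠ 0 := fun h => by simpa using congrArg Complex.im h
  have hs : 0 < s.im := by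
    have : 0 < Complex.normSq (p + Complex.I) := Complex.normSq_pos.2 hpI
    simp only [s, Complex.neg_im, Complex.inv_im, neg_div, neg_neg]
    exact div_pos (by simp) this
  have hqw : (q * Complex.I + w : ℂ) ≠ 0 := fun h => by
    have := congrArg Complex.re h
    simp at this
    exact hneg.ne this
  have hden0 : den 0 = (q * Complex.I + w) * (p + Complex.I)⁻¹ := by
    simp only [den, s, hp, hq, hw]
    field_simp
    ring
  have hden : den 0 ≠ 0 := by
    rw [hden0]
    exact mul_ne_zero hqw (inv_ne_zero hpI)
  have ht0 : t 0 = -Complex.I / (q * Complex.I + w) := by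
    simp only [t, hden0, s, hp]
    field_simp
    ring
  have htim : 0 < (t 0).im := by
    have h5 : 0 < Complex.normSq (q * Complex.I + w) := Complex.normSq_pos.2 hqw
    rw [ht0, Complex.div_im]
    have h6 : -w / Complex.normSq (q * Complex.I + w) =
        (-Complex.I).im * (q * Complex.I + w : ℂ).re / Complex.normSq (q * Complex.I + w) -
        (-Complex.I).re * (q * Complex.I + w : ℂ).im / Complex.normSq (q * Complex.I + w) := by
      simp
    rw [← h6]
    exact div_pos (neg_pos.2 hneg) h5
  have hMc : Continuous M := by
    refine Continuous.add (Continuous.matrix_diagonal ?_) continuous_const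
    fun_prop
  have hdc : ContinuousAt (fun ε => (M ε).det) 0 := hMc.matrix_det.continuousAt
  have hinv : ∀ a b, ContinuousAt (fun ε => (M ε)⁻¹ a b) 0 := by
    intro a b
    have : (fun ε => (M ε)⁻¹ a b) = fun ε => ((M ε).det)⁻¹ * (M ε).adjugate a b := by
      ext ε
      rw [Matrix.inv_def, Ring.inverse_eq_inv', Matrix.smul_apply, smul_eq_mul]
    rw [this]
    exact (hdc.inv₀ hx).mul (hMc.matrix_adjugate.matrix_elem a b).continuousAt
  have hdenc : ContinuousAt den 0 :=
    ((hinv j j).mul (continuousAt_const.add (continuousAt_const.mul (hinv i i)))).sub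
      (continuousAt_const.mul ((hinv i j).mul (hinv j i)))
  have htc : ContinuousAt t 0 :=
    (continuousAt_const.add (continuousAt_const.mul (hinv i i))).neg.div hdenc hden
  have e1 := hdc.eventually_ne hx
  have e2 := hdenc.eventually_ne hden
  have e3 : ∀ᶠ ε in nhds (0 : ℝ), 0 < (t ε).im :=
    (Complex.continuous_im.continuousAt.comp htc).eventually_const_lt htim
  obtain ⟨ε, ⟨⟨hε1, hε2⟩, hε3⟩, hε⟩ := (((e1.and e2).and e3).filter_mono nhdsWithin_le_nhds |>.and
    (self_mem_nhdsWithin : Set.Ioi (0 : ℝ) ∈ nhdsWithin 0 (Set.Ioi 0))).exists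
  have hdet := det_diagonal_add_two hε1 hij s (t ε)
  have hzero : (1 + s * (M ε)⁻¹ i i) * (1 + t ε * (M ε)⁻¹ j j) -
      s * t ε * ((M ε)⁻¹ i j * (M ε)⁻¹ j i) = 0 := by
    have h7 : t ε * den ε = -(1 + s * (M ε)⁻¹ i i) := div_mul_cancel₀ _ hε2
    simp only [den] at h7
    linear_combination h7
  rw [hzero, mul_zero] at hdet
  refine hA.2 (fun k => x k + ε * Complex.I + (Pi.single i s + Pi.single j (t ε) : ι → ℂ) k) ?_ ?_
  · intro k
    have h8 : ((x k : ℂ) + ε * Complex.I).im = ε := by simp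
    rw [Complex.add_im, h8]
    have hε' : 0 < ε := hε
    rw [Pi.add_apply, Complex.add_im, Pi.single_apply, Pi.single_apply]
    split_ifs <;> simp <;> positivity
  · rw [eval_detPoly, ← hdet, ← Matrix.diagonal_add, add_right_comm]

end Stable

/-! ### Hermitian scaling -/

/-- If `(a - τ b) (c - τ d)` is a nonnegative real number for all real `τ` but one, then the two
roots of this real quadratic are conjugate: either they are not real, or they coincide, since a
nonnegative quadratic has no simple real zero. -/
theorem mul_eq_star_mul_of_quadratic_nonneg {a b c d : ℂ} (hac : ∃ w : ℝ, 0 < w ∧ a * c = w)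
    (hbd : ∃ y : ℝ, 0 < y ∧ b * d = y) (τ₀ : ℝ)
    (h : ∀ τ : ℝ, τ ≠ τ₀ → ∃ w : ℝ, 0 ≤ w ∧ (a - τ * b) * (c - τ * d) = w) :
    a * d = star (b * c) := by
  obtain ⟨w, hw, hac⟩ := hac
  obtain ⟨y, hy, hbd⟩ := hbd
  set u := b * c with hu
  set v := a * d with hv
  have huv : u * v = ((w * y : ℝ) : ℂ) := by
    push_cast
    rw [← hac, ← hbd]
    ring
  have hq : ∀ τ : ℝ, (a - τ * b) * (c - τ * d) = (w : ℂ) - τ * (u + v) + τ * τ * y := by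
    intro τ
    rw [← hac, ← hbd]
    ring
  obtain ⟨τ₁, h₁, h₁'⟩ : ∃ τ : ℝ, τ ≠ τ₀ ∧ τ ≠ 0 := by
    by_cases h1 : (1 : ℝ) = τ₀
    · exact ⟨2, by rw [← h1]; norm_num, by norm_num⟩
    · exact ⟨1, h1, by norm_num⟩
  have him : u.im + v.im = 0 := by
    obtain ⟨r, -, hr⟩ := h τ₁ h₁
    rw [hq] at hr
    have := congrArg Complex.im hr
    simp at this
    exact this.resolve_left h₁'
  have him2 : u.re * v.im + u.im * v.re = 0 := by
    have := congrArg Complex.im huv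
    rwa [Complex.mul_im, Complex.ofReal_im] at this
  have hre2 : u.re * v.re - u.im * v.im = w * y := by
    have := congrArg Complex.re huv
    rwa [Complex.mul_re, Complex.ofReal_re] at this
  suffices hre : v.re = u.re by
    refine Complex.ext ?_ ?_
    · simpa using hre
    · simp only [Complex.star_def, Complex.conj_im]
      linarith
  by_cases hu0 : u.im = 0
  · have hv0 : v.im = 0 := by linarith
    have hpos : ∀ τ : ℝ, 0 ≤ y * (τ * τ) + -(u.re + v.re) * τ + w := by
      intro τ
      have hp : ∀ τ : ℝ, τ ≠ τ₀ → 0 ≤ y * (τ * τ) + -(u.re + v.re) * τ + w := by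
        intro τ hτ
        obtain ⟨r, hr0, hr⟩ := h τ hτ
        rw [hq] at hr
        have := congrArg Complex.re hr
        simp at this
        linarith
      have hcl : IsClosed {τ : ℝ | 0 ≤ y * (τ * τ) + -(u.re + v.re) * τ + w} :=
        isClosed_le continuous_const (by fun_prop)
      have hsub : closure ({τ₀}ᶜ : Set ℝ) ⊆ {τ : ℝ | 0 ≤ y * (τ * τ) + -(u.re + v.re) * τ + w} :=
        hcl.closure_subset_iff.2 hp
      exact hsub (by rw [(dense_compl_singleton τ₀).closure_eq]; trivial)
    have hdisc := discrim_le_zero hpos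
    rw [discrim] at hdisc
    rw [hu0, zero_mul, sub_zero] at hre2
    have : (v.re - u.re) ^ 2 ≤ 0 := by nlinarith
    have := pow_eq_zero_iff (two_ne_zero) |>.1 (le_antisymm this (sq_nonneg _))
    linarith
  · have : u.im * (v.re - u.re) = 0 := by
      have : v.im = -u.im := by linarith
      rw [this] at him2
      linarith
    rcases mul_eq_zero.1 this with h | h
    · exact absurd h hu0
    · linarith

section Hermitian

variable {ι : Type*} [Fintype ι] [DecidableEq ι]

theorem IsRealStable.inv_triple {A : Matrix ι ι ℂ} (hA : IsRealStable (detPoly A))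
    (x : ι → ℝ) (hx : (Matrix.diagonal (fun i => (x i : ℂ)) + A).det ≠ 0)
    (hB : ∀ i j, (Matrix.diagonal (fun i => (x i : ℂ)) + A)⁻¹ i j ≠ 0) {B : Matrix ι ι ℂ}
    (hBA : (Matrix.diagonal (fun i => (x i : ℂ)) + A)⁻¹ = B)
    {i j k : ι} (hij : i ≠ j) (hik : i ≠ k) (hjk : j ≠ k) :
    B i j * (B j k * B k i) = star ((B i k * B k j) * B j i) := by
  have hpos : ∀ a b, a ≠ b → ∃ w : ℝ, 0 < w ∧ B a b * B b a = w := by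
    intro a b hab
    obtain ⟨w, hw, h⟩ := hA.inv_mul_inv_nonneg x hx hab
    rw [hBA] at h
    refine ⟨w, lt_of_le_of_ne hw ?_, h⟩
    rintro rfl
    rw [Complex.ofReal_zero] at h
    exact mul_ne_zero (hBA ▸ hB a b) (hBA ▸ hB b a) h
  obtain ⟨β, hβ⟩ : ∃ β : ℝ, B k k = β :=
    ⟨_, Complex.ext rfl (hBA ▸ hA.inv_diag_im_eq_zero x hx k)⟩
  refine mul_eq_star_mul_of_quadratic_nonneg (hpos i j hij) ?_ β⁻¹ ?_
  · obtain ⟨w, hw, h⟩ := hpos i k hik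
    obtain ⟨y, hy, h'⟩ := hpos k j hjk.symm
    refine ⟨w * y, mul_pos hw hy, ?_⟩
    push_cast
    rw [← h, ← h']
    ring
  · intro τ hτ
    -- The increment `t` of `x k` for which the rank one update has coefficient `τ`.
    set t : ℝ := τ / (1 - τ * β) with ht
    have h1 : 1 - τ * β ≠ 0 := fun h0 => hτ (eq_inv_of_mul_eq_one_left (by linarith))
    have h2 : 1 + t * β = (1 - τ * β)⁻¹ := by
      rw [ht]
      field_simp
      ring
    have h3 : t / (1 + t * β) = τ := by
      rw [h2, ht]
      field_simp
    have h4 : Matrix.diagonal (fun i => (((x + Pi.single k t : ι → ℝ) i : ℝ) : ℂ)) + A =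
        Matrix.diagonal (fun i => (x i : ℂ)) + A + Matrix.diagonal (Pi.single k (t : ℂ)) := by
      rw [add_right_comm, Matrix.diagonal_add]
      congr 2
      ext i
      by_cases h : i = k
      · subst h; simp
      · simp [h]
    obtain ⟨h5, h6⟩ := inv_add_diagonal_single hx k (t : ℂ) (by
      rw [hBA, hβ]
      exact_mod_cast h2 ▸ inv_ne_zero h1)
    rw [← h4] at h5 h6
    obtain ⟨w, hw, h⟩ := hA.inv_mul_inv_nonneg _ h5 hij
    refine ⟨w, hw, ?_⟩
    rw [← h, h6, h6, hBA, hβ, ← h3]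
    push_cast
    ring

/-- Off-diagonal relations `b_ij b_jk b_ki = conj (b_ik b_kj b_ji)` make the positive ratios
`b_ji / conj b_ij` a coboundary, so that a real diagonal scaling makes `A` Hermitian. -/
theorem IsRealStable.exists_weights {A : Matrix ι ι ℂ} (hA : IsRealStable (detPoly A))
    (x : ι → ℝ) (hx : (Matrix.diagonal (fun i => (x i : ℂ)) + A).det ≠ 0)
    (hB : ∀ i j, (Matrix.diagonal (fun i => (x i : ℂ)) + A)⁻¹ i j ≠ 0) :
    ∃ ρ : ι → ℝ, (∀ i, 0 < ρ i) ∧ ∀ i j, A i j * ρ j = star (A j i) * ρ i := by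
  rcases isEmpty_or_nonempty ι with hι | ⟨⟨o⟩⟩
  · exact ⟨fun _ => 1, fun i => isEmptyElim i, fun i => isEmptyElim i⟩
  obtain ⟨B, hBA⟩ : ∃ B, (Matrix.diagonal (fun i => (x i : ℂ)) + A)⁻¹ = B := ⟨_, rfl⟩
  set N := Matrix.diagonal (fun i => (x i : ℂ)) + A with hN
  have hB0 : ∀ i j, B i j ≠ 0 := hBA ▸ hB
  have hdiag : ∀ i, star (B i i) = B i i := fun i =>
    Complex.conj_eq_iff_im.2 (hBA ▸ hA.inv_diag_im_eq_zero x hx i)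
  have hpos : ∀ i j, i ≠ j → ∃ w : ℝ, 0 ≤ w ∧ B i j * B j i = w := fun i j hij =>
    hBA ▸ hA.inv_mul_inv_nonneg x hx hij
  have hreal : ∀ i j, star (B i j * B j i) = B i j * B j i := by
    intro i j
    by_cases hij : i = j
    · subst hij
      rw [star_mul, hdiag]
    · obtain ⟨w, -, hw⟩ := hpos i j hij
      rw [hw]
      exact Complex.conj_ofReal w
  have htriple : ∀ i j k, B i j * (B j k * B k i) = star ((B i k * B k j) * B j i) := by
    intro i j k
    by_cases hij : i = j
    · subst hij
      rw [star_mul, hreal, hdiag]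
    by_cases hik : i = k
    · subst hik
      rw [mul_assoc, star_mul, hreal, hdiag]
      ring
    by_cases hjk : j = k
    · subst hjk
      rw [mul_right_comm, star_mul, hreal, hdiag]
      ring
    exact hA.inv_triple x hx hB hBA hij hik hjk
  have hσ : ∀ i, ∃ r : ℝ, 0 < r ∧ B i o / star (B o i) = r := by
    intro i
    have hs : star (B o i) ≠ 0 := star_ne_zero.2 (hB0 o i)
    by_cases hio : i = o
    · subst hio
      exact ⟨1, one_pos, by rw [hdiag, div_self (hB0 i i), Complex.ofReal_one]⟩
    · obtain ⟨w, hw0, hw⟩ := hpos i o hio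
      have hn : 0 < Complex.normSq (B o i) := Complex.normSq_pos.2 (hB0 o i)
      have hw1 : w ≠ 0 := by
        rintro rfl
        exact mul_ne_zero (hB0 i o) (hB0 o i) (by simpa using hw)
      refine ⟨w / Complex.normSq (B o i), div_pos (lt_of_le_of_ne hw0 hw1.symm) hn, ?_⟩
      rw [Complex.ofReal_div, ← hw, Complex.normSq_eq_conj_mul_self, mul_div_mul_right _ _ (hB0 o i)]
      rfl
  choose ρ hρ hρB using hσ
  have hBρ : ∀ i j, B i j * ρ j = star (B j i) * ρ i := by
    intro i j
    have hi : star (B o i) ≠ 0 := star_ne_zero.2 (hB0 o i)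
    have hj : star (B o j) ≠ 0 := star_ne_zero.2 (hB0 o j)
    rw [← hρB, ← hρB, mul_div_assoc', mul_div_assoc', div_eq_div_iff hj hi]
    apply mul_right_cancel₀ (hB0 o i)
    have h1 := htriple i j o
    have h2 := hreal i o
    simp only [star_mul] at h1 h2
    linear_combination star (B o i) * h1 + star (B j i) * star (B o j) * h2
  have hNB : N * B = 1 := by rw [← hBA]; exact Matrix.mul_nonsing_inv _ (Ne.isUnit hx)
  have hBN : B * N = 1 := by rw [← hBA]; exact Matrix.nonsing_inv_mul _ (Ne.isUnit hx)
  let P : Matrix ι ι ℂ := Matrix.diagonal fun i => (ρ i : ℂ)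
  have hBP : B * P = P * B.conjTranspose := by
    ext i j
    rw [Matrix.mul_diagonal, Matrix.diagonal_mul, Matrix.conjTranspose_apply, hBρ, mul_comm]
  have hNP : N * P = P * N.conjTranspose := by
    have h1 : B.conjTranspose * N.conjTranspose = 1 := by
      rw [← Matrix.conjTranspose_mul, hNB, Matrix.conjTranspose_one]
    calc N * P = N * P * (B.conjTranspose * N.conjTranspose) := by rw [h1, Matrix.mul_one]
      _ = N * (P * B.conjTranspose) * N.conjTranspose := by simp only [Matrix.mul_assoc]
      _ = (N * B) * P * N.conjTranspose := by rw [← hBP]; simp only [Matrix.mul_assoc]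
      _ = P * N.conjTranspose := by rw [hNB, Matrix.one_mul]
  refine ⟨ρ, hρ, fun i j => ?_⟩
  have h := congrFun (congrFun hNP i) j
  rw [Matrix.mul_diagonal, Matrix.diagonal_mul, Matrix.conjTranspose_apply, hN, Matrix.add_apply,
    Matrix.add_apply] at h
  by_cases hij : i = j
  · subst hij
    simp only [Matrix.diagonal_apply_eq, star_add, Complex.star_def, Complex.conj_ofReal] at h ⊢
    linear_combination h
  · rw [Matrix.diagonal_apply_ne _ hij, Matrix.diagonal_apply_ne _ (Ne.symm hij), zero_add,
      zero_add] at h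
    rw [h, mul_comm]

end Hermitian

/-! ### Irreducible matrices -/

theorem exists_real_eval_ne_zero {σ : Type*} {p : MvPolynomial σ ℂ} (hp : p ≠ 0) :
    ∃ x : σ → ℝ, eval (fun i => (x i : ℂ)) p ≠ 0 := by
  by_contra! h
  refine hp (funext_set (fun _ => Set.range (fun r : ℝ => (r : ℂ)))
    (fun _ => Set.infinite_range_of_injective Complex.ofReal_injective) fun z hz => ?_)
  choose x hx using fun i => hz i trivial
  have : z = fun i => (x i : ℂ) := by ext1 i; exact (hx i).symm
  rw [this, h, map_zero]

theorem eval_add_single_of_notMem_vars {σ : Type*} [DecidableEq σ] {p : MvPolynomial σ ℂ}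
    {i : σ} (hi : i ∉ p.vars)
    (z : σ → ℂ) (s : ℂ) : eval (z + Pi.single i s) p = eval z p := by
  refine hom_congr_vars (by ext; simp) (fun k hk _ => ?_) rfl
  have : k ≠ i := fun h => hi (h ▸ hk)
  simp [this]

section Generic

variable {ι : Type*} [Fintype ι] [DecidableEq ι]

/-- For an irreducible matrix `A` and generic real `x`, no entry of `(diag x + A)⁻¹` vanishes. If
the entries `j ∈ T` of row `a` vanished identically, then the rank one update of the inverse under
a change of `x k`, `k ∉ T`, would force the entries `(k, j)` with `j ∈ T` to vanish too; so the
inverse, and with it `A`, would be block triangular. -/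
theorem IsIrreducibleMatrix.exists_inv_ne_zero {A : Matrix ι ι ℂ} (hA : IsIrreducibleMatrix A) :
    ∃ x : ι → ℝ, (Matrix.diagonal (fun i => (x i : ℂ)) + A).det ≠ 0 ∧
      ∀ i j, (Matrix.diagonal (fun i => (x i : ℂ)) + A)⁻¹ i j ≠ 0 := by
  classical
  let G : Matrix ι ι (MvPolynomial ι ℂ) := (Matrix.diagonal (fun i => X i) + A.map C).adjugate
  have hG : ∀ (z : ι → ℂ) i j, eval z (G i j) = (Matrix.diagonal z + A).adjugate i j := by
    intro z i j
    have h1 : (eval z).mapMatrix (Matrix.diagonal (fun i => X i) + A.map C) =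
        Matrix.diagonal z + A := by
      ext i j
      by_cases h : i = j
      · subst h; simp
      · simp [h]
    rw [← h1, ← RingHom.map_adjugate]
    rfl
  let P : MvPolynomial ι ℂ := detPoly A * ∏ i, ∏ j, if G i j = 0 then 1 else G i j
  have hP : P ≠ 0 := by
    refine mul_ne_zero (detPoly_ne_zero A) (Finset.prod_ne_zero_iff.2 fun i _ =>
      Finset.prod_ne_zero_iff.2 fun j _ => ?_)
    split_ifs with h
    exacts [one_ne_zero, h]
  obtain ⟨x, hx⟩ := exists_real_eval_ne_zero hP
  rw [map_mul, map_prod, eval_detPoly] at hx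
  have hdet := left_ne_zero_of_mul hx
  have hinv : ∀ y : ι → ℝ, ∀ i j, (Matrix.diagonal (fun i => (y i : ℂ)) + A)⁻¹ i j =
      (Matrix.diagonal (fun i => (y i : ℂ)) + A).det⁻¹ * eval (fun i => (y i : ℂ)) (G i j) := by
    intro y i j
    rw [Matrix.inv_def, Ring.inverse_eq_inv', Matrix.smul_apply, smul_eq_mul, hG]
  have hne : ∀ i j, G i j ≠ 0 → (Matrix.diagonal (fun i => (x i : ℂ)) + A)⁻¹ i j ≠ 0 := by
    intro i j hij
    have h1 := Finset.prod_ne_zero_iff.1 (right_ne_zero_of_mul hx) i (Finset.mem_univ i)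
    rw [map_prod] at h1
    have h2 := Finset.prod_ne_zero_iff.1 h1 j (Finset.mem_univ j)
    rw [if_neg hij] at h2
    rw [hinv]
    exact mul_ne_zero (inv_ne_zero hdet) h2
  refine ⟨x, hdet, fun a c => hne a c fun hac => ?_⟩
  set N := Matrix.diagonal (fun i => (x i : ℂ)) + A with hN
  have hNB : N * N⁻¹ = 1 := Matrix.mul_nonsing_inv _ (Ne.isUnit hdet)
  have hBN : N⁻¹ * N = 1 := Matrix.nonsing_inv_mul _ (Ne.isUnit hdet)
  let T : Set ι := {j | G a j = 0}
  have hTc : Tᶜ.Nonempty := by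
    by_contra hT
    rw [Set.not_nonempty_iff_eq_empty, Set.compl_empty_iff] at hT
    have hrow : ∀ j, N⁻¹ a j = 0 := fun j => by
      have : G a j = 0 := by
        have : j ∈ T := hT ▸ Set.mem_univ j
        exact this
      rw [hinv, this, map_zero, mul_zero]
    have := congrFun (congrFun hBN a) a
    rw [Matrix.mul_apply, Matrix.one_apply_eq] at this
    simp [hrow] at this
  have hblock : ∀ k ∉ T, ∀ j ∈ T, N⁻¹ k j = 0 := by
    intro k hk j hj
    obtain ⟨t, ht0, ht⟩ : ∃ t : ℝ, t ≠ 0 ∧ 1 + (t : ℂ) * N⁻¹ k k ≠ 0 := by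
      by_cases h1 : 1 + ((1 : ℝ) : ℂ) * N⁻¹ k k = 0
      · refine ⟨2, two_ne_zero, fun h2 => one_ne_zero (α := ℂ) ?_⟩
        push_cast at h1 h2
        linear_combination 2 * h1 - h2
      · exact ⟨1, one_ne_zero, h1⟩
    have h4 : Matrix.diagonal (fun i => (((x + Pi.single k t : ι → ℝ) i : ℝ) : ℂ)) + A =
        N + Matrix.diagonal (Pi.single k (t : ℂ)) := by
      rw [hN, add_right_comm, Matrix.diagonal_add]
      congr 2
      ext i
      by_cases h : i = k
      · subst h; simp
      · simp [h]
    have h5 := (inv_add_diagonal_single hdet k (t : ℂ) ht).2 a j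
    have hj' : G a j = 0 := hj
    rw [← h4, hinv, hinv x a j, hj', map_zero, mul_zero, map_zero, mul_zero, zero_sub, eq_comm,
      neg_eq_zero, mul_eq_zero, div_eq_zero_iff, Complex.ofReal_eq_zero, mul_eq_zero] at h5
    rcases h5 with (h5 | h5) | (h5 | h5)
    · exact absurd h5 ht0
    · exact absurd h5 ht
    · exact absurd h5 (hne a k hk)
    · exact h5
  refine hA.2 ((isReducibleMatrix_iff A).2 ⟨T, ⟨c, hac⟩, hTc, fun k hk j hj => ?_⟩)
  let b : ι → Bool := fun i => decide (i ∉ T)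
  have hb : N⁻¹.BlockTriangular b := by
    intro i j hij
    have h1 : i ∉ T ∧ j ∈ T := by
      by_cases h1 : i ∈ T <;> by_cases h2 : j ∈ T <;> simp [b, h1, h2] at hij ⊢
      exact absurd hij (by decide)
    exact hblock i h1.1 j h1.2
  let _ : Invertible N⁻¹ := ⟨N, hNB, hBN⟩
  have hbN := Matrix.blockTriangular_inv_of_blockTriangular hb
  rw [Matrix.nonsing_inv_nonsing_inv _ (Ne.isUnit hdet)] at hbN
  have h6 : N k j = 0 := hbN (by simp [b, hk, hj])
  have hkj : k ≠ j := fun h => hk (h ▸ hj)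
  rw [hN, Matrix.add_apply, Matrix.diagonal_apply_ne _ hkj, zero_add] at h6
  exact h6

/-- An irreducible matrix whose polynomial is real stable is diagonally equivalent to a Hermitian
matrix. -/
theorem IsIrreducibleMatrix.exists_isHermitian {A : Matrix ι ι ℂ} (hA : IsIrreducibleMatrix A)
    (hs : IsRealStable (detPoly A)) :
    ∃ H : Matrix ι ι ℂ, H.IsHermitian ∧ IsIrreducibleMatrix H ∧
      ∃ d : ι → ℂ, (∀ i, d i ≠ 0) ∧
        A = Matrix.diagonal d * H * Matrix.diagonal (fun i => (d i)⁻¹) := by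
  obtain ⟨x, hx, hB⟩ := hA.exists_inv_ne_zero
  obtain ⟨ρ, hρ, hAρ⟩ := hs.exists_weights x hx hB
  let d : ι → ℂ := fun i => (Real.sqrt (ρ i) : ℂ)
  have hd : ∀ i, d i ≠ 0 := fun i => Complex.ofReal_ne_zero.2 (Real.sqrt_pos.2 (hρ i)).ne'
  have hdd : ∀ i, d i * d i = ρ i := fun i => by
    rw [← Complex.ofReal_mul, Real.mul_self_sqrt (hρ i).le]
  have hstar : ∀ i, star (d i) = d i := fun i => Complex.conj_ofReal _
  refine ⟨Matrix.of fun i j => (d i)⁻¹ * A i j * d j, ?_, ?_, d, hd, ?_⟩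
  · ext i j
    rw [Matrix.conjTranspose_apply, Matrix.of_apply, Matrix.of_apply]
    simp only [star_mul, star_inv₀, hstar]
    have h := hAρ i j
    rw [← hdd, ← hdd] at h
    have hi := hd i
    have hj := hd j
    field_simp
    linear_combination -h
  · refine hA.congr fun i j hij => ?_
    have : (d i)⁻¹ * A i j * d j = 0 := hij
    simpa [hd] using this
  · ext i j
    rw [Matrix.mul_diagonal, Matrix.diagonal_mul, Matrix.of_apply]
    have hi := hd i
    have hj := hd j
    field_simp

theorem degreeOf_detPoly_le (A : Matrix ι ι ℂ) (i : ι) : degreeOf i (detPoly A) ≤ 1 := by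
  rw [detPoly, Matrix.det_apply']
  refine (degreeOf_sum_le _ _ _).trans (Finset.sup_le fun σ _ => ?_)
  have h0 : degreeOf i (((Equiv.Perm.sign σ : ℤ) : MvPolynomial ι ℂ)) = 0 := by
    have : (((Equiv.Perm.sign σ : ℤ) : MvPolynomial ι ℂ)) = C ((Equiv.Perm.sign σ : ℤ) : ℂ) := by
      simp
    rw [this, degreeOf_C]
  refine (degreeOf_mul_le _ _ _).trans ?_
  rw [h0, zero_add]
  refine (degreeOf_prod_le _ _ _).trans ?_
  have hle : ∀ k, degreeOf i ((Matrix.diagonal (fun i => (X i : MvPolynomial ι ℂ)) + A.map C :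
      Matrix ι ι (MvPolynomial ι ℂ)) (σ k) k) ≤ if i = k then 1 else 0 := by
    intro k
    refine (degreeOf_add_le _ _ _).trans (max_le ?_ ?_)
    · by_cases h : σ k = k
      · rw [h, Matrix.diagonal_apply_eq, degreeOf_X]
      · rw [Matrix.diagonal_apply_ne _ h, degreeOf_zero]
        exact Nat.zero_le _
    · rw [Matrix.map_apply, degreeOf_C]
      exact Nat.zero_le _
  refine (Finset.sum_le_sum fun k _ => hle k).trans ?_
  simp

/-- The polynomial of an irreducible matrix is irreducible. As it is of degree at most one in each
variable, a proper factorization `g * h` splits the variables; if `x i` occurs in `g` and `x j` in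
`h`, then as a function of `x i` and `x j` alone the polynomial is a product of functions of one
variable, so that the entries `(i, j)` and `(j, i)` of `(diag x + A)⁻¹` have product zero. -/
theorem IsIrreducibleMatrix.irreducible_detPoly {A : Matrix ι ι ℂ} (hA : IsIrreducibleMatrix A) :
    Irreducible (detPoly A) := by
  classical
  obtain ⟨x, hx, hB⟩ := hA.exists_inv_ne_zero
  have hcase : ∀ p : MvPolynomial ι ℂ, p ≠ 0 → p.vars = ∅ → IsUnit p := by
    intro p hp hv
    obtain hc := vars_eq_empty_iff_eq_C.1 hv
    rw [hc] at hp ⊢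
    exact (Ne.isUnit fun h => hp (by rw [h, C_0])).map C
  constructor
  · intro hu
    obtain ⟨c, -, hc⟩ := isUnit_iff_eq_C_of_isReduced.1 hu
    obtain ⟨i⟩ := hA.1
    have h1 := det_diagonal_add_single hx i 1
    rw [add_right_comm, Matrix.diagonal_add, ← eval_detPoly, ← eval_detPoly, hc, eval_C, eval_C]
      at h1
    rw [← eval_detPoly, hc, eval_C] at hx
    have h2 : c * (1 * (Matrix.diagonal (fun i => (x i : ℂ)) + A)⁻¹ i i) = 0 := by
      linear_combination -h1
    exact mul_ne_zero hx (mul_ne_zero one_ne_zero (hB i i)) h2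
  · intro g h hgh
    have hgh0 : g * h ≠ 0 := hgh ▸ detPoly_ne_zero A
    have hg0 := left_ne_zero_of_mul hgh0
    have hh0 := right_ne_zero_of_mul hgh0
    have hdisj : ∀ k, k ∈ g.vars → k ∉ h.vars := by
      intro k hkg hkh
      have := degreeOf_detPoly_le A k
      rw [hgh, degreeOf_mul_eq hg0 hh0] at this
      have h1 := mem_vars_iff_degreeOf_ne_zero.1 hkg
      have h2 := mem_vars_iff_degreeOf_ne_zero.1 hkh
      omega
    rcases g.vars.eq_empty_or_nonempty with hg | ⟨i, hi⟩
    · exact Or.inl (hcase g hg0 hg)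
    rcases h.vars.eq_empty_or_nonempty with hh | ⟨j, hj⟩
    · exact Or.inr (hcase h hh0 hh)
    exfalso
    have hig := hdisj i hi
    have hjg : j ∉ g.vars := fun hjg => hdisj j hjg hj
    have hij : i ≠ j := fun hij => hig (hij ▸ hj)
    set z : ι → ℂ := fun i => (x i : ℂ) with hz
    have e0 : (Matrix.diagonal z + A).det = eval z g * eval z h := by
      rw [← eval_detPoly, hgh, map_mul]
    have e1 := det_diagonal_add_single hx i 1
    have e2 := det_diagonal_add_single hx j 1
    have e3 := det_diagonal_add_two hx hij 1 1
    rw [add_right_comm, Matrix.diagonal_add, ← eval_detPoly, hgh, map_mul] at e1 e2 e3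
    have f1 := eval_add_single_of_notMem_vars hig z 1
    have f2 := eval_add_single_of_notMem_vars hjg z 1
    have f3 := eval_add_single_of_notMem_vars hjg (z + Pi.single i 1) 1
    have f4 := eval_add_single_of_notMem_vars hig (z + Pi.single j 1) 1
    have e1' : eval (z + Pi.single i 1) g * eval (z + Pi.single i 1) h = _ := e1
    have e2' : eval (z + Pi.single j 1) g * eval (z + Pi.single j 1) h = _ := e2
    have e3' : eval (z + (Pi.single i 1 + Pi.single j 1)) g *
      eval (z + (Pi.single i 1 + Pi.single j 1)) h = _ := e3
    rw [← add_assoc, f3, add_right_comm, f4] at e3'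
    rw [f1] at e1'
    rw [f2] at e2'
    have hz0 : eval z g * eval z h ≠ 0 := e0 ▸ hx
    have : (Matrix.diagonal z + A).det * ((Matrix.diagonal z + A).det *
        ((Matrix.diagonal z + A)⁻¹ i j * (Matrix.diagonal z + A)⁻¹ j i)) = 0 := by
      set D := (Matrix.diagonal z + A).det
      set p := (Matrix.diagonal z + A)⁻¹ i i
      set q := (Matrix.diagonal z + A)⁻¹ j j
      set w := (Matrix.diagonal z + A)⁻¹ i j * (Matrix.diagonal z + A)⁻¹ j i
      set gi := eval (z + Pi.single i 1) g
      set hj := eval (z + Pi.single j 1) h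
      -- `f(i) f(j) = f(0) f(i, j)`, where arguments are the shifted coordinates
      linear_combination (-(eval z g * hj)) * e1' - D * (1 + 1 * p) * e2' + D * e3' +
        gi * hj * (-e0)
    exact mul_ne_zero hx (mul_ne_zero hx (mul_ne_zero (hB i j) (hB j i))) this

end Generic

/-! ### Factorizations over a subfield -/

section Descent

theorem irreducible_rename {σ τ F : Type*} [Field F] {u : σ → τ} (hu : Function.Injective u)
    {p : MvPolynomial σ F} (hp : Irreducible p) : Irreducible (rename u p) := by
  classical
  have hinj := rename_injective (R := F) u hu
  constructor
  · intro h
    apply hp.not_isUnit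
    simpa [killCompl_rename_app] using h.map (killCompl hu)
  · intro g h hgh
    have h0 : g * h ≠ 0 := hgh ▸ (map_ne_zero_iff _ hinj).2 hp.ne_zero
    have hg0 := left_ne_zero_of_mul h0
    have hh0 := right_ne_zero_of_mul h0
    have hvars : ∀ i, i ∉ Set.range u → degreeOf i g = 0 ∧ degreeOf i h = 0 := by
      intro i hi
      have h1 : degreeOf i (g * h) = 0 := by
        by_contra h2
        rw [← hgh] at h2
        obtain ⟨k, -, hk⟩ :=
          Finset.mem_image.1 (vars_rename u p (mem_vars_iff_degreeOf_ne_zero.2 h2))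
        exact hi ⟨k, hk⟩
      rw [degreeOf_mul_eq hg0 hh0] at h1
      omega
    obtain ⟨g', rfl⟩ := exists_rename_eq_of_vars_subset_range g u hu fun i hi => by
      by_contra h1
      exact mem_vars_iff_degreeOf_ne_zero.1 hi (hvars i h1).1
    obtain ⟨h', rfl⟩ := exists_rename_eq_of_vars_subset_range h u hu fun i hi => by
      by_contra h1
      exact mem_vars_iff_degreeOf_ne_zero.1 hi (hvars i h1).2
    rw [← map_mul] at hgh
    exact (hp.isUnit_or_isUnit (hinj hgh)).imp (fun h => h.map _) (fun h => h.map _)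

theorem irreducible_of_map_algebraMap {σ K L : Type*} [Field K] [Field L] [Algebra K L]
    {p : MvPolynomial σ K} (hp : Irreducible (map (algebraMap K L) p)) : Irreducible p := by
  have : IsLocalHom (map (σ := σ) (algebraMap K L)) := by
    refine ⟨fun q hq => ?_⟩
    rw [isUnit_iff] at hq ⊢
    simpa only [coeff_map, isUnit_map_iff,
      IsNilpotent.map_iff (algebraMap K L).injective] using hq
  exact hp.of_map

theorem aeval_X_detPoly {κ S : Type*} [Fintype κ] [DecidableEq κ] [CommRing S] (A : Matrix κ κ S) :
    aeval (fun _ => (Polynomial.X : Polynomial S)) (detPoly A) = (-A).charpoly := by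
  rw [detPoly, AlgHom.map_det, Matrix.charpoly]
  congr 1
  ext1 i j
  by_cases h : i = j
  · subst h; simp
  · simp [h, Matrix.charmatrix_apply_ne]

/-- If `det (diag x + A) * Q` has coefficients in the subfield `K` and `Q` only involves further
variables, then `det (diag x + A)` has coefficients in `K`: specialize the further variables to
natural numbers at which `Q` does not vanish, and divide by the leading coefficient. -/
theorem exists_map_eq_detPoly {κ τ K L : Type*} [Fintype κ] [DecidableEq κ] [Field K] [Field L]
    [CharZero L] [Algebra K L] (A : Matrix κ κ L) {u : κ → τ} (hu : Function.Injective u)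
    {Q : MvPolynomial τ L} (hQ0 : Q ≠ 0) (hQ : ∀ i ∈ Q.vars, i ∉ Set.range u) {f : MvPolynomial τ K}
    (hf : map (algebraMap K L) f = rename u (detPoly A) * Q) :
    ∃ p : MvPolynomial κ K, map (algebraMap K L) p = detPoly A := by
  classical
  obtain ⟨c, hc⟩ : ∃ c : τ → ℕ, eval (fun i => (c i : L)) Q ≠ 0 := by
    by_contra! h
    refine hQ0 (funext_set (fun _ => Set.range (fun r : ℕ => (r : L)))
      (fun _ => Set.infinite_range_of_injective Nat.cast_injective) fun z hz => ?_)
    choose x hx using fun i => hz i trivial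
    have : z = fun i => (x i : L) := by ext1 i; exact (hx i).symm
    rw [this, h, map_zero]
  set e := eval (fun i => (c i : L)) Q with he
  let wK : τ → MvPolynomial κ K := fun i => if h : i ∈ Set.range u then X h.choose else C (c i : K)
  let wL : τ → MvPolynomial κ L := fun i => if h : i ∈ Set.range u then X h.choose else C (c i : L)
  have hwL : ∀ k, wL (u k) = X k := by
    intro k
    have h : u k ∈ Set.range u := ⟨k, rfl⟩
    simp only [wL, dif_pos h]
    rw [hu h.choose_spec]
  have hw : ∀ i, map (algebraMap K L) (wK i) = wL i := by
    intro i
    simp only [wK, wL]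
    split_ifs <;> simp
  have hcomm : ∀ p, map (algebraMap K L) (aeval wK p) = aeval wL (map (algebraMap K L) p) := by
    intro p
    have : (map (algebraMap K L)).comp (aeval wK : MvPolynomial τ K →ₐ[K] _).toRingHom =
        (aeval wL : MvPolynomial τ L →ₐ[L] _).toRingHom.comp (map (algebraMap K L)) := by
      ext i : 2
      · simp [algebraMap_eq]
      · simp [hw]
    exact RingHom.congr_fun this p
  have hP : aeval wL (rename u (detPoly A)) = detPoly A := by
    rw [aeval_rename, show wL ∘ u = X from funext hwL, aeval_X_left_apply]
  have hQe : aeval wL Q = C e := by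
    refine hom_congr_vars (f₁ := (aeval wL : MvPolynomial τ L →ₐ[L] _).toRingHom)
      (f₂ := C.comp (eval fun i => (c i : L))) (by ext; simp [algebraMap_eq]) (fun i hi _ => ?_) rfl
    have : wL i = C (c i : L) := dif_neg (hQ i hi)
    simp [this]
  set p₀ := aeval wK f with hp₀
  have hp₀map : map (algebraMap K L) p₀ = detPoly A * C e := by
    rw [hp₀, hcomm, hf, map_mul, hP, hQe]
  set l := (aeval (fun _ : κ => (Polynomial.X : Polynomial K)) p₀).leadingCoeff with hl
  have hle : algebraMap K L l = e := by
    have h1 : (aeval (fun _ : κ => (Polynomial.X : Polynomial K)) p₀).map (algebraMap K L) =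
        aeval (fun _ : κ => (Polynomial.X : Polynomial L)) (map (algebraMap K L) p₀) := by
      have : (Polynomial.mapRingHom (algebraMap K L)).comp
          (aeval (fun _ : κ => (Polynomial.X : Polynomial K))).toRingHom =
          (aeval (fun _ : κ => (Polynomial.X : Polynomial L))).toRingHom.comp
            (map (algebraMap K L)) := by
        ext i : 2 <;> simp [Polynomial.algebraMap_eq]
      exact RingHom.congr_fun this p₀
    have h2 := congrArg Polynomial.leadingCoeff h1
    rw [Polynomial.leadingCoeff_map, hp₀map, map_mul, aeval_X_detPoly, aeval_C,
      Polynomial.algebraMap_eq, Polynomial.leadingCoeff_mul, Polynomial.leadingCoeff_C,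
      (Matrix.charpoly_monic _).leadingCoeff, one_mul] at h2
    exact h2
  refine ⟨p₀ * C l⁻¹, ?_⟩
  rw [map_mul, hp₀map, map_C, map_inv₀, hle, mul_assoc, ← C_mul, mul_inv_cancel₀ hc, C_1, mul_one]

end Descent

/-- Two factorizations into irreducibles, indexed by finite types, match up to a bijection of the
index types. -/
theorem exists_equiv_associated {α κ μ : Type*} [Fintype κ] [Fintype μ] [CommMonoidWithZero α]
    [UniqueFactorizationMonoid α] {f : κ → α} {g : μ → α} (hf : ∀ k, Irreducible (f k))
    (hg : ∀ k, Irreducible (g k)) (h : ∏ k, f k = ∏ k, g k) :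
    ∃ σ : κ ≃ μ, ∀ k, Associated (f k) (g (σ k)) := by
  classical
  have hrel : Multiset.Rel Associated (Finset.univ.val.map f) (Finset.univ.val.map g) := by
    refine UniqueFactorizationMonoid.factors_unique ?_ ?_ (Associated.of_eq h)
    · simpa using hf
    · simpa using hg
  have heq := Multiset.map_mk_eq_map_mk_of_rel hrel
  rw [Multiset.map_map, Multiset.map_map] at heq
  have hcard : ∀ c : Quot (Associated (M := α)),
      Fintype.card {a // Quot.mk _ (f a) = c} = Fintype.card {b // Quot.mk _ (g b) = c} := by
    intro c
    have := congrArg (Multiset.count c) heq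
    rw [Multiset.count_map, Multiset.count_map] at this
    rw [Fintype.card_subtype, Fintype.card_subtype]
    simpa [Finset.card, Finset.filter, eq_comm] using this
  let σ : κ ≃ μ := Equiv.ofFiberEquiv (f := fun a => Quot.mk (Associated (M := α)) (f a))
    (g := fun b => Quot.mk (Associated (M := α)) (g b)) fun c => Fintype.equivOfCardEq (hcard c)
  refine ⟨σ, fun k => ?_⟩
  have : Quot.mk (Associated (M := α)) (g (σ k)) = Quot.mk _ (f k) :=
    Equiv.ofFiberEquiv_map (f := fun a => Quot.mk (Associated (M := α)) (f a))
      (g := fun b => Quot.mk (Associated (M := α)) (g b)) _ k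
  exact (Associates.mk_eq_mk_iff_associated.1 this).symm

/-! ### The converse and the block decomposition -/

theorem IsRealStable.rename {σ τ : Type*} {p : MvPolynomial σ ℂ} (hp : IsRealStable p) (u : σ → τ) :
    IsRealStable (rename u p) := by
  obtain ⟨⟨g, rfl⟩, h⟩ := hp
  refine ⟨⟨MvPolynomial.rename u g, map_rename _ _ _⟩, fun z hz => ?_⟩
  rw [eval_rename]
  exact h _ fun i => hz (u i)

theorem IsRealStable.prod {σ κ : Type*} [Fintype κ] {p : κ → MvPolynomial σ ℂ}
    (hp : ∀ k, IsRealStable (p k)) : IsRealStable (∏ k, p k) := by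
  choose g hg using fun k => (hp k).1
  refine ⟨⟨∏ k, g k, by simp only [map_prod, hg]⟩, fun z hz => ?_⟩
  rw [map_prod]
  exact Finset.prod_ne_zero_iff.2 fun k _ => (hp k).2 z hz

section Hermitian

variable {ι : Type*} [Fintype ι] [DecidableEq ι]

/-- If `H` is Hermitian and `(diag z + H) v = 0`, then the imaginary part of `v* (diag z + H) v`
gives `∑ Im z_i |v_i|² = 0`. -/
theorem isRealStable_detPoly_of_isHermitian {H : Matrix ι ι ℂ} (hH : H.IsHermitian) :
    IsRealStable (detPoly H) := by
  constructor
  · have hconj : map (starRingEnd ℂ) (detPoly H) = detPoly H := by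
      rw [map_detPoly, ← detPoly_transpose]
      congr 1
    have hmem : detPoly H ∈ Set.range (map Complex.ofRealHom) := by
      rw [mem_range_map_iff_coeffs_subset]
      intro a ha
      obtain ⟨d, -, rfl⟩ := mem_coeffs_iff.1 ha
      have h := congrArg (coeff d) hconj
      rw [coeff_map] at h
      obtain ⟨r, hr⟩ := Complex.conj_eq_iff_real.1 h
      exact ⟨r, hr.symm⟩
    exact hmem
  · intro z hz h0
    rw [eval_detPoly] at h0
    obtain ⟨v, hv, hv0⟩ := Matrix.exists_mulVec_eq_zero_iff.2 h0
    have h1 : star v ⬝ᵥ ((Matrix.diagonal z + H).mulVec v) = 0 := by rw [hv0, dotProduct_zero]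
    rw [Matrix.add_mulVec, dotProduct_add] at h1
    have h2 : (star v ⬝ᵥ H.mulVec v).im = 0 := hH.im_star_dotProduct_mulVec_self v
    have h3 : (star v ⬝ᵥ (Matrix.diagonal z).mulVec v).im =
        ∑ i, (z i).im * Complex.normSq (v i) := by
      rw [dotProduct, Complex.im_sum]
      refine Finset.sum_congr rfl fun i _ => ?_
      rw [Matrix.mulVec_diagonal, Pi.star_apply]
      have : star (v i) * (z i * v i) = z i * (Complex.normSq (v i) : ℂ) := by
        rw [Complex.normSq_eq_conj_mul_self, Complex.star_def]
        ring
      rw [this, Complex.im_mul_ofReal]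
    have h4 := congrArg Complex.im h1
    rw [Complex.add_im, h2, h3, add_zero, Complex.zero_im] at h4
    obtain ⟨i, hi⟩ := Function.ne_iff.1 hv
    have h5 : 0 < ∑ i, (z i).im * Complex.normSq (v i) :=
      Finset.sum_pos' (fun j _ => mul_nonneg (hz j).le (Complex.normSq_nonneg _))
        ⟨i, Finset.mem_univ i, mul_pos (hz i) (Complex.normSq_pos.2 hi)⟩
    exact h5.ne' h4

theorem isRealStable_detPoly_of_blockTriangular {A : Matrix ι ι ℂ} {s : ℕ} {m : Fin s → ℕ}
    (e : (Σ k : Fin s, Fin (m k)) ≃ ι) (h : (A.submatrix e e).BlockTriangular Sigma.fst)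
    (hH : ∀ k, ∃ H : Matrix (Fin (m k)) (Fin (m k)) ℂ,
      H.IsHermitian ∧ DiagEquivalent ((A.submatrix e e).blockDiag' k) H) :
    IsRealStable (detPoly A) := by
  rw [detPoly_eq_prod_of_blockTriangular e A h]
  refine IsRealStable.prod fun k => IsRealStable.rename ?_ _
  obtain ⟨H, hH, hAH⟩ := hH k
  rw [hAH.detPoly_eq]
  exact isRealStable_detPoly_of_isHermitian hH

end Hermitian

theorem principalMinor_diagonal_conj {ι F : Type*} [Fintype ι] [DecidableEq ι] [Field F] {d : ι → F}
    (hd : ∀ i, d i ≠ 0) (H : Matrix ι ι F) (S : Finset ι) :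
    principalMinor (Matrix.diagonal d * H * Matrix.diagonal (fun i => (d i)⁻¹)) S =
      principalMinor H S := by
  have key : (Matrix.diagonal d * H * Matrix.diagonal (fun i => (d i)⁻¹)).submatrix
      (fun i : S => (i : ι)) (fun i : S => (i : ι)) =
      Matrix.diagonal (fun i : S => d i) *
        H.submatrix (fun i : S => (i : ι)) (fun i : S => (i : ι)) *
        Matrix.diagonal (fun i : S => (d i)⁻¹) := by
    ext i j
    simp [Matrix.mul_diagonal, Matrix.diagonal_mul]
  rw [principalMinor, key, Matrix.det_mul, Matrix.det_mul, mul_right_comm, ← Matrix.det_mul,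
    Matrix.diagonal_mul_diagonal]
  simp [hd, principalMinor]

section Blocks

variable {ι : Type*} [Fintype ι] [DecidableEq ι]

/-- The polynomials of the diagonal blocks have coefficients in every field that contains the
coefficients of the polynomial of the whole matrix. -/
theorem exists_map_eq_detPoly_blockDiag' {K : Type*} [Field K] [Algebra K ℂ] {A : Matrix ι ι ℂ}
    {s : ℕ} {m : Fin s → ℕ} (e : (Σ k : Fin s, Fin (m k)) ≃ ι)
    (h : (A.submatrix e e).BlockTriangular Sigma.fst) {f : MvPolynomial ι K}
    (hf : map (algebraMap K ℂ) f = detPoly A) (k : Fin s) :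
    ∃ p : MvPolynomial (Fin (m k)) K,
      map (algebraMap K ℂ) p = detPoly ((A.submatrix e e).blockDiag' k) := by
  classical
  have hinj : ∀ k, Function.Injective (fun i : Fin (m k) => e ⟨k, i⟩) := fun k =>
    e.injective.comp sigma_mk_injective
  refine exists_map_eq_detPoly _ (hinj k) (f := f) (Q := ∏ l ∈ Finset.univ.erase k,
    MvPolynomial.rename (fun i => e ⟨l, i⟩) (detPoly ((A.submatrix e e).blockDiag' l))) ?_ ?_ ?_
  · exact Finset.prod_ne_zero_iff.2 fun l _ =>
      (map_ne_zero_iff _ (rename_injective _ (hinj l))).2 (detPoly_ne_zero _)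
  · rintro i hi ⟨a, rfl⟩
    obtain ⟨l, hl, hi⟩ := Finset.mem_biUnion.1 (vars_prod _ hi)
    obtain ⟨b, -, hb⟩ := Finset.mem_image.1 (vars_rename _ _ hi)
    exact (Finset.mem_erase.1 hl).1 (congrArg Sigma.fst (e.injective hb))
  · rw [hf, detPoly_eq_prod_of_blockTriangular e A h]
    exact (Finset.mul_prod_erase _ _ (Finset.mem_univ k)).symm

theorem IsRealStable.blockDiag' {A : Matrix ι ι ℂ} (hA : IsRealStable (detPoly A))
    {s : ℕ} {m : Fin s → ℕ} (e : (Σ k : Fin s, Fin (m k)) ≃ ι)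
    (h : (A.submatrix e e).BlockTriangular Sigma.fst) (k : Fin s) :
    IsRealStable (detPoly ((A.submatrix e e).blockDiag' k)) := by
  obtain ⟨g, hg⟩ := hA.1
  refine ⟨exists_map_eq_detPoly_blockDiag' e h (K := ℝ) hg k, fun z hz h0 => ?_⟩
  have hinj : Function.Injective (fun i : Fin (m k) => e ⟨k, i⟩) :=
    e.injective.comp sigma_mk_injective
  let z' : ι → ℂ := Function.extend (fun i : Fin (m k) => e ⟨k, i⟩) z fun _ => Complex.I
  refine hA.2 z' (fun i => ?_) ?_
  · by_cases hi : ∃ a, e ⟨k, a⟩ = i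
    · obtain ⟨a, rfl⟩ := hi
      rw [show z' (e ⟨k, a⟩) = z a from hinj.extend_apply _ _ a]
      exact hz a
    · rw [show z' i = Complex.I from Function.extend_apply' _ _ _ hi]
      simp
  · rw [detPoly_eq_prod_of_blockTriangular e A h, map_prod]
    refine Finset.prod_eq_zero (Finset.mem_univ k) ?_
    rw [eval_rename, show z' ∘ (fun i : Fin (m k) => e ⟨k, i⟩) = z from
      Function.extend_comp hinj _ _]
    exact h0

/-- Any factorization of the polynomial of `A` into irreducibles is, up to order and units, the one
given by the diagonal blocks of the Frobenius normal form of `A`. -/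
theorem exists_blocks_of_factorization {K : Type*} [Field K] [Algebra K ℂ] {n : ℕ}
    (A : Matrix (Fin n) (Fin n) ℂ) {s : ℕ} {g : Fin s → MvPolynomial (Fin n) K}
    (hg : ∀ k, Irreducible (g k)) (hf : map (algebraMap K ℂ) (∏ k, g k) = detPoly A) :
    ∃ (m : Fin s → ℕ) (e : (Σ k : Fin s, Fin (m k)) ≃ Fin n) (σ : Equiv.Perm (Fin s)),
      (A.submatrix e e).BlockTriangular Sigma.fst ∧
      ∀ k, IsIrreducibleMatrix ((A.submatrix e e).blockDiag' k) ∧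
        ∃ c : ℂ, c ≠ 0 ∧ map (algebraMap K ℂ) (g (σ k)) =
          C c * MvPolynomial.rename (fun i => e ⟨k, i⟩)
            (detPoly ((A.submatrix e e).blockDiag' k)) := by
  obtain ⟨r, m, e, htri, hirr⟩ := exists_equiv_blockTriangular_irreducible A
  choose p hp using fun k => exists_map_eq_detPoly_blockDiag' e htri hf k
  have hp' : ∀ k, map (algebraMap K ℂ) (MvPolynomial.rename (fun i => e ⟨k, i⟩) (p k)) =
      MvPolynomial.rename (fun i => e ⟨k, i⟩) (detPoly ((A.submatrix e e).blockDiag' k)) :=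
    fun k => by rw [map_rename, hp]
  have hpirr : ∀ k, Irreducible (MvPolynomial.rename (fun i => e ⟨k, i⟩) (p k)) := fun k =>
    irreducible_rename (e.injective.comp sigma_mk_injective)
      (irreducible_of_map_algebraMap (L := ℂ) (hp k ▸ (hirr k).irreducible_detPoly))
  have hprod : ∏ k, MvPolynomial.rename (fun i => e ⟨k, i⟩) (p k) = ∏ k, g k := by
    apply map_injective _ (algebraMap K ℂ).injective
    rw [hf, map_prod, detPoly_eq_prod_of_blockTriangular e A htri]
    exact Finset.prod_congr rfl fun k _ => hp' k
  obtain ⟨σ, hσ⟩ := exists_equiv_associated hpirr hg hprod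
  obtain rfl : r = s := by simpa using Fintype.card_congr σ
  refine ⟨m, e, σ, htri, fun k => ⟨hirr k, ?_⟩⟩
  obtain ⟨u, hu⟩ := hσ k
  obtain ⟨c, hc, huc⟩ := isUnit_iff_eq_C_of_isReduced.1 u.isUnit
  refine ⟨algebraMap K ℂ c, (hc.map (algebraMap K ℂ)).ne_zero, ?_⟩
  rw [← hu, huc, map_mul, hp', map_C, mul_comm]

theorem isIrreducibleMatrix_of_irreducible {K : Type*} [Field K] [Algebra K ℂ] {n : ℕ}
    {A : Matrix (Fin n) (Fin n) ℂ} {f : MvPolynomial (Fin n) K} (hf : Irreducible f)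
    (hA : map (algebraMap K ℂ) f = detPoly A) : IsIrreducibleMatrix A := by
  obtain ⟨m, e, -, -, h⟩ := exists_blocks_of_factorization A (s := 1) (g := fun _ => f)
    (fun _ => hf) (by simpa using hA)
  let w : Fin (m default) ≃ Fin n := (Equiv.uniqueSigma fun k => Fin (m k)).symm.trans e
  have h1 : (A.submatrix e e).blockDiag' default = A.submatrix w w := rfl
  have h2 := (h default).1
  rw [h1] at h2
  have h3 := h2.submatrix w.symm
  rwa [Matrix.submatrix_submatrix, Equiv.self_comp_symm, Matrix.submatrix_id_id] at h3

end Blocks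

end StableMatrix

theorem corollary7p3 {K : Type*} [Field K] [Algebra K ℂ] {n : ℕ}
    (A : Matrix (Fin n) (Fin n) ℂ) :
    (StableMatrix.IsRealStable (StableMatrix.detPoly A) →
      ∀ f : MvPolynomial (Fin n) K,
        MvPolynomial.map (algebraMap K ℂ) f = StableMatrix.detPoly A →
        -- the irreducible case
        (Irreducible f →
          ∃ H : Matrix (Fin n) (Fin n) ℂ,
            H.IsHermitian ∧ StableMatrix.IsIrreducibleMatrix H ∧
            StableMatrix.DiagEquivalent A H ∧
            ∀ S : Finset (Fin n),
              StableMatrix.principalMinor A S = StableMatrix.principalMinor H S) ∧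
        -- the general case
        (∀ (s : ℕ) (g : Fin s → MvPolynomial (Fin n) K),
          (∀ k, Irreducible (g k)) → f = ∏ k, g k →
          ∃ (m : Fin s → ℕ) (e : (Σ k : Fin s, Fin (m k)) ≃ Fin n) (σ : Equiv.Perm (Fin s)),
            (A.submatrix e e).BlockTriangular Sigma.fst ∧
            ∀ k : Fin s,
              StableMatrix.IsIrreducibleMatrix ((A.submatrix e e).blockDiag' k) ∧
              ∃ H : Matrix (Fin (m k)) (Fin (m k)) ℂ,
                H.IsHermitian ∧ StableMatrix.IsIrreducibleMatrix H ∧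
                StableMatrix.DiagEquivalent ((A.submatrix e e).blockDiag' k) H ∧
                StableMatrix.detPoly ((A.submatrix e e).blockDiag' k) =
                  StableMatrix.detPoly H ∧
                -- the variable attached to row `i` of block `k` is `x_{e ⟨k, i⟩}`
                ∃ c : ℂ, c ≠ 0 ∧
                  MvPolynomial.map (algebraMap K ℂ) (g (σ k)) =
                    MvPolynomial.C c * MvPolynomial.rename (fun i => e ⟨k, i⟩)
                      (StableMatrix.detPoly H))) ∧
    -- the converse
    (∀ (s : ℕ) (m : Fin s → ℕ) (e : (Σ k : Fin s, Fin (m k)) ≃ Fin n),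
      (A.submatrix e e).BlockTriangular Sigma.fst →
      (∀ k : Fin s, ∃ H : Matrix (Fin (m k)) (Fin (m k)) ℂ,
        H.IsHermitian ∧ StableMatrix.DiagEquivalent ((A.submatrix e e).blockDiag' k) H) →
      StableMatrix.IsRealStable (StableMatrix.detPoly A)) := by
  refine ⟨fun hA f hf => ⟨fun hirr => ?_, fun s g hg hfg => ?_⟩, fun s m e htri hH =>
    StableMatrix.isRealStable_detPoly_of_blockTriangular e htri hH⟩
  · obtain ⟨H, hH, hHirr, d, hd, hAH⟩ :=
      (StableMatrix.isIrreducibleMatrix_of_irreducible hirr hf).exists_isHermitian hA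
    refine ⟨H, hH, hHirr, ⟨d, hd, Or.inl hAH⟩, fun S => ?_⟩
    rw [hAH, StableMatrix.principalMinor_diagonal_conj hd]
  · obtain ⟨m, e, σ, htri, hblocks⟩ :=
      StableMatrix.exists_blocks_of_factorization A hg (hfg ▸ hf)
    refine ⟨m, e, σ, htri, fun k => ⟨(hblocks k).1, ?_⟩⟩
    obtain ⟨H, hH, hHirr, d, hd, hAH⟩ := (hblocks k).1.exists_isHermitian (hA.blockDiag' e htri k)
    have hequiv : StableMatrix.DiagEquivalent ((A.submatrix e e).blockDiag' k) H :=
      ⟨d, hd, Or.inl hAH⟩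
    refine ⟨H, hH, hHirr, hequiv, hequiv.detPoly_eq, ?_⟩
    rw [← hequiv.detPoly_eq]
    exact (hblocks k).2
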